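/- For a topological space $X$ let $C_k(X)$ be the space of continuous functions $X\to\mathbb R$ with the compact-open topology. A topological space is Suslin if it is the image of a Polish space under a continuous map. $X$ is Ascoli if the map $X\to C_k(C_k(X))$, $x\mapsto\delta_x$, where $\delta_x(f)=f(x)$, is continuous. A uniformity on a set $X$ is $\omega^\omega$-based if it has a base $(U_\alpha)_{\alpha\in\omega^\omega}$ such that $U_\beta\subseteq U_\alpha$ whenever $\alpha\le\beta$, where $\alpha\le\beta$ means $\alpha(n)\le\beta(n)$ for all $n\in\omega$. A uniformity on a topological space $X$ is $\mathbb R$-universal if it generates the topology of $X$ and every continuous function $X\to\mathbb R$ is uniformly continuous with respect to it. Theorem 1.5. Let $X$ be a Tychonoff space. (1) If $X$ is separable and has an $\mathbb R$-universal $\omega^\omega$-based uniformity, then $C_k(X)$ is Suslin. (2) If $X$ is Ascoli and $C_k(X)$ is Suslin, then $X$ is separable and has an $\mathbb R$-universal $\omega^\omega$-based uniformity. -/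

import Mathlib

open Filter Topology Uniformity

universe u v

/-- A topological space is Suslin if it is the image of a Polish space under a continuous map.
Every Polish space is homeomorphic to one in `Type`, so nothing is lost by letting `P` range over
`Type` only; see `isSuslin_of_polishSpace`. -/
def IsSuslin (Y : Type u) [TopologicalSpace Y] : Prop :=
  ∃ (P : Type) (_ : TopologicalSpace P) (_ : PolishSpace P) (f : P → Y),
    Continuous f ∧ Function.Surjective f

/-- A continuous image of a Polish space living in an arbitrary universe is Suslin. -/
theorem isSuslin_of_polishSpace {Y : Type u} [TopologicalSpace Y] {P : Type v}
    [TopologicalSpace P] [PolishSpace P] {f : P → Y} (hf : Continuous f)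
    (hs : Function.Surjective f) : IsSuslin Y := by
  have h := MeasureTheory.analyticSet_range_of_polishSpace hf
  rw [hs.range_eq, MeasureTheory.analyticSet_iff_exists_polishSpace_range] at h
  obtain ⟨Q, tQ, pQ, g, hg, hr⟩ := h
  exact ⟨Q, tQ, pQ, g, hg, Set.range_eq_univ.mp hr⟩

/-- The Dirac functional `δ_x : C_k(X) → ℝ`, `f ↦ f x`, as a point of `C_k(C_k(X))`. Here and below
`C(X, ℝ)` carries Mathlib's topology on it, which is the compact-open one. -/
def diracFunctional {X : Type u} [TopologicalSpace X] (x : X) : C(C(X, ℝ), ℝ) where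
  toFun f := f x
  continuous_toFun := continuous_eval_const x

/-- `X` is Ascoli if the canonical map `X → C_k(C_k(X))`, `x ↦ δ_x`, is continuous. -/
def IsAscoli (X : Type u) [TopologicalSpace X] : Prop :=
  Continuous (diracFunctional : X → C(C(X, ℝ), ℝ))

/-- A uniformity is `ω^ω`-based if it has a base `(U_α)`, indexed by `α ∈ ω^ω`, with `U_β ⊆ U_α`
whenever `α ≤ β` in the coordinatewise order. -/
def IsOmegaOmegaBased {X : Type u} (𝒰 : UniformSpace X) : Prop :=
  ∃ U : (ℕ → ℕ) → Set (X × X), 𝓤[𝒰].HasBasis (fun _ => True) U ∧ ∀ α β, α ≤ β → U β ⊆ U α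

/-- A uniformity on a topological space `X` is `ℝ`-universal if it generates the topology of `X`
and every continuous function `X → ℝ` is uniformly continuous with respect to it. -/
def IsRealUniversal {X : Type u} [t : TopologicalSpace X] (𝒰 : UniformSpace X) : Prop :=
  𝒰.toTopologicalSpace = t ∧
    ∀ f : X → ℝ, Continuous[t, _] f → @UniformContinuous X ℝ 𝒰 _ f

/-!
For (1), fix a countable dense set `D` and code `f : C(X, ℝ)` by a pair `(A, f|_D)`, where
`A : ω → ω^ω` is a modulus of uniform continuity of `f`. If a sequence of codes converges in the
Polish space `(ω^ω)^ω × ℝ^D`, then its moduli are dominated by a single one, so the coded functions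
are equicontinuous and converge pointwise on `D`, hence converge in `C_k(X)`. Decoding therefore
extends continuously to the closure of the set of codes.

For (2), a continuous surjection `Φ : ω^ω → C_k(X)` induces the map `x ↦ δ_x ∘ Φ` from `X` to
`C_k(ω^ω)`. It is continuous because `X` is Ascoli, and a topological embedding because `X` is
Tychonoff. Compact subsets of `ω^ω` are contained in boxes `{β | β ≤ α}`, so the uniformity of
`C_k(ω^ω)` is `ω^ω`-based, and so is its pullback to `X`.
-/

section Extension

theorem exists_tendsto_of_forall_seq {T : Type*} {Y : Type*} [TopologicalSpace Y] [T2Space Y]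
    {l : Filter T} [l.NeBot] [l.IsCountablyGenerated] {e : T → Y}
    (h : ∀ u : ℕ → T, Tendsto u atTop l → ∃ y, Tendsto (e ∘ u) atTop (𝓝 y)) :
    ∃ y, Tendsto e l (𝓝 y) := by
  obtain ⟨u, hu⟩ := exists_seq_tendsto l
  obtain ⟨y, hy⟩ := h u hu
  refine ⟨y, tendsto_of_seq_tendsto fun v hv => ?_⟩
  -- Interleaving `u` and `v` shows that `e ∘ u` and `e ∘ v` have the same limit.
  let w : ℕ → T := fun n => if Even n then u (n / 2) else v (n / 2)
  have hhalf : Tendsto (· / 2 : ℕ → ℕ) atTop atTop := Nat.tendsto_div_const_atTop two_ne_zero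
  have hw : Tendsto w atTop l := (hu.comp hhalf).if' (hv.comp hhalf)
  have hw_even (n : ℕ) : w (2 * n) = u n := by simp [w]
  have hw_odd (n : ℕ) : w (2 * n + 1) = v n := by
    simp [w, Nat.mul_add_div, parity_simps]
  obtain ⟨z, hz⟩ := h w hw
  have hdouble : Tendsto (2 * · : ℕ → ℕ) atTop atTop := tendsto_id.const_mul_atTop' two_pos
  have hzu : Tendsto (e ∘ u) atTop (𝓝 z) := by
    simpa only [Function.comp_def, hw_even] using hz.comp hdouble
  have hzv : Tendsto (e ∘ v) atTop (𝓝 z) := by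
    simpa only [Function.comp_def, hw_odd] using hz.comp ((tendsto_add_atTop_nat 1).comp hdouble)
  rwa [tendsto_nhds_unique hy hzu]

theorem isSuslin_of_forall_seq {T : Type*} {P : Type v} {Y : Type u} [TopologicalSpace P]
    [PolishSpace P] [TopologicalSpace Y] [T3Space Y] (c : T → P) {e : T → Y}
    (he : Function.Surjective e)
    (h : ∀ (u : ℕ → T) (p : P), Tendsto (c ∘ u) atTop (𝓝 p) → ∃ y, Tendsto (e ∘ u) atTop (𝓝 y)) :
    IsSuslin Y := by
  let Q := closure (Set.range c)
  let i : T → Q := fun t => ⟨c t, subset_closure ⟨t, rfl⟩⟩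
  have : PolishSpace Q := isClosed_closure.polishSpace
  let _ : TopologicalSpace T := .induced i inferInstance
  have hi : IsDenseInducing i :=
    ⟨⟨rfl⟩, Subtype.dense_iff.2 fun p hp => by rwa [← Set.range_comp]⟩
  have hlim (q : Q) : ∃ y, Tendsto e (comap i (𝓝 q)) (𝓝 y) := by
    have := hi.comap_nhds_neBot q
    refine exists_tendsto_of_forall_seq fun u hu => h u q ?_
    exact (continuous_subtype_val.tendsto q).comp (tendsto_comap_iff.1 hu)
  exact isSuslin_of_polishSpace (hi.continuous_extend hlim) fun y =>
    (he y).imp' i fun t ht => (hi.extend_eq' hlim t).trans ht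

end Extension

section Equicontinuity

variable {ι : Type*} {X : Type*} {E : Type*} [TopologicalSpace X] [UniformSpace E]
  {F : ι → C(X, E)} {l : Filter ι}

theorem cauchy_map_eval_of_dense [l.NeBot] (hF : Equicontinuous fun i => ⇑(F i)) {D : Set X}
    (hD : Dense D) (h : ∀ d ∈ D, Cauchy (l.map fun i => F i d)) (x : X) :
    Cauchy (l.map fun i => F i x) := by
  refine cauchy_map_iff'.2 fun V hV => ?_
  obtain ⟨W, hW, hW_symm, hWV⟩ := comp_comp_symm_mem_uniformity_sets hV
  obtain ⟨d, hd, hdW⟩ := hD.inter_nhds_nonempty (hF x W hW)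
  have hWd : ∀ᶠ ij in l ×ˢ l, (F ij.1 d, F ij.2 d) ∈ W := cauchy_map_iff'.1 (h d hd) hW
  rw [mem_map]
  filter_upwards [hWd] with ij hij
  exact hWV ⟨_, ⟨_, hdW ij.1, hij⟩, SetRel.symm W (hdW ij.2)⟩

theorem tendsto_continuousMap_of_equicontinuous (hF : Equicontinuous fun i => ⇑(F i))
    {f : C(X, E)} (h : ∀ x, Tendsto (fun i => F i x) l (𝓝 (f x))) : Tendsto F l (𝓝 f) := by
  rw [ContinuousMap.isUniformEmbedding_toUniformOnFunIsCompact.isInducing.tendsto_nhds_iff]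
  have hcover : ⋃₀ {K : Set X | IsCompact K} = Set.univ :=
    Set.sUnion_eq_univ_iff.2 fun x => ⟨{x}, isCompact_singleton, rfl⟩
  exact (EquicontinuousOn.tendsto_uniformOnFun_iff_pi (fun _ hK => hK) hcover
    (fun K _ => hF.equicontinuousOn K) l f).2 (tendsto_pi_nhds.2 h)

theorem exists_tendsto_continuousMap_of_dense [CompleteSpace E] [l.NeBot]
    (hF : Equicontinuous fun i => ⇑(F i)) {D : Set X} (hD : Dense D)
    (h : ∀ d ∈ D, Cauchy (l.map fun i => F i d)) : ∃ f, Tendsto F l (𝓝 f) := by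
  choose f hf using fun x => CompleteSpace.complete (cauchy_map_eval_of_dense hF hD h x)
  have hf_cont : Continuous f :=
    Tendsto.continuous_of_equicontinuous (tendsto_pi_nhds.2 hf) hF
  exact ⟨⟨f, hf_cont⟩, tendsto_continuousMap_of_equicontinuous hF hf⟩

end Equicontinuity

section Modulus

variable {ι X E : Type*} {U : (ℕ → ℕ) → Set (X × X)} {V : ℕ → Set (E × E)} {A B : ℕ → ℕ → ℕ}

/-- `A : ω → ω^ω` is a modulus of uniform continuity of `f` with respect to bases `(U_α)` and
`(V_n)` of the uniformities of the domain and of the codomain: `f` maps `U_{A n}` into `V_n`. -/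
def HasModulus (U : (ℕ → ℕ) → Set (X × X)) (V : ℕ → Set (E × E)) (A : ℕ → ℕ → ℕ) (f : X → E) :
    Prop :=
  ∀ n, Set.MapsTo (Prod.map f f) (U (A n)) (V n)

theorem HasModulus.mono (hU : Antitone U) (hAB : A ≤ B) {f : X → E} (hf : HasModulus U V A f) :
    HasModulus U V B f :=
  fun n => (hf n).mono_left (hU (hAB n))

theorem HasModulus.uniformEquicontinuous [UniformSpace X] [UniformSpace E]
    (hU : ∀ α, U α ∈ 𝓤 X) (hV : (𝓤 E).HasBasis (fun _ => True) V) {F : ι → X → E}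
    (hF : ∀ i, HasModulus U V A (F i)) : UniformEquicontinuous F :=
  (hV.uniformEquicontinuous_iff_right).2 fun n _ =>
    mem_of_superset (hU (A n)) fun _ hp i => hF i n hp

theorem exists_hasModulus [UniformSpace X] [UniformSpace E]
    (hU : (𝓤 X).HasBasis (fun _ => True) U) (hV : ∀ n, V n ∈ 𝓤 E) {f : X → E}
    (hf : UniformContinuous f) : ∃ A, HasModulus U V A f := by
  choose A hA using fun n => hU.mem_iff.1 (hf (hV n))
  exact ⟨A, fun n => (hA n).2⟩

end Modulus

theorem IsOmegaOmegaBased.isSuslin_continuousMap {X : Type u} {E : Type v} [𝒰 : UniformSpace X]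
    [TopologicalSpace.SeparableSpace X] [UniformSpace E] [CompleteSpace E]
    [(𝓤 E).IsCountablyGenerated] [PolishSpace E] (h𝒰 : IsOmegaOmegaBased 𝒰)
    (huc : ∀ f : C(X, E), UniformContinuous f) : IsSuslin C(X, E) := by
  obtain ⟨U, hU, hU_anti⟩ := h𝒰
  obtain ⟨V, hV⟩ := (𝓤 E).exists_antitone_basis
  obtain ⟨D, hD_count, hD⟩ := TopologicalSpace.exists_countable_dense X
  have : Countable D := hD_count.to_subtype
  let T := {q : (ℕ → ℕ → ℕ) × C(X, E) // HasModulus U V q.1 q.2}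
  let code : T → (ℕ → ℕ → ℕ) × (D → E) := fun q => (q.1.1, fun d => q.1.2 d)
  have hdecode : Function.Surjective fun q : T => q.1.2 := fun f =>
    have ⟨A, hA⟩ := exists_hasModulus hU hV.mem (huc f)
    ⟨⟨(A, f), hA⟩, rfl⟩
  refine isSuslin_of_forall_seq code hdecode fun u p hu => ?_
  obtain ⟨hu_mod, hu_val⟩ := Prod.tendsto_iff _ _ |>.1 hu
  obtain ⟨B, hB⟩ : BddAbove (Set.range fun k => (u k).1.1) :=
    bddAbove_range_pi.2 fun n => bddAbove_range_pi.2 fun m =>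
      ((hu_mod.apply_nhds n).apply_nhds m).bddAbove_range
  have heq : UniformEquicontinuous fun k => ⇑(u k).1.2 :=
    HasModulus.uniformEquicontinuous (fun α => hU.mem_of_mem trivial) hV.toHasBasis fun k =>
      (u k).2.mono hU_anti (hB ⟨k, rfl⟩)
  exact exists_tendsto_continuousMap_of_dense heq.equicontinuous hD fun d hd =>
    (hu_val.apply_nhds ⟨d, hd⟩).cauchy_map

theorem uniformContinuous_eval_continuousMap {X E : Type*} [TopologicalSpace X] [UniformSpace E]
    (x : X) : UniformContinuous fun f : C(X, E) => f x :=
  (UniformOnFun.uniformContinuous_eval_of_mem E {K : Set X | IsCompact K} (Set.mem_singleton x)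
    isCompact_singleton).comp
      ContinuousMap.isUniformEmbedding_toUniformOnFunIsCompact.uniformContinuous

section OmegaOmegaBased

theorem IsOmegaOmegaBased.comap {X : Type u} {Y : Type v} {𝒰 : UniformSpace Y}
    (h : IsOmegaOmegaBased 𝒰) (g : X → Y) : IsOmegaOmegaBased (𝒰.comap g) :=
  have ⟨_, hU, hU_anti⟩ := h
  ⟨_, hU.comap (Prod.map g g), fun α β hαβ => Set.preimage_mono (hU_anti α β hαβ)⟩

theorem isOmegaOmegaBased_continuousMap {E : Type v} [UniformSpace E]
    [(𝓤 E).IsCountablyGenerated] :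
    IsOmegaOmegaBased (inferInstance : UniformSpace C(ℕ → ℕ, E)) := by
  obtain ⟨V, hV⟩ := (𝓤 E).exists_antitone_basis
  refine ⟨fun α => {fg | ∀ β ≤ α, (fg.1 β, fg.2 β) ∈ V (α 0)}, ?_, fun α α' h fg hfg β hβ =>
    hV.antitone (h 0) (hfg β (hβ.trans h))⟩
  refine hV.toHasBasis.compactConvergenceUniformity.to_hasBasis ?_ fun α _ => ?_
  · rintro ⟨K, n⟩ ⟨hK, -⟩
    obtain ⟨α, hα⟩ : BddAbove K :=
      bddAbove_pi.2 fun m => (hK.image (continuous_apply m)).bddAbove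
    refine ⟨α ⊔ fun _ => n, trivial, fun fg hfg β hβ => ?_⟩
    exact hV.antitone (le_sup_right : n ≤ α 0 ⊔ n) (hfg β ((hα hβ).trans le_sup_left))
  · exact ⟨(Set.Icc ⊥ α, α 0), ⟨isCompact_Icc, trivial⟩, fun fg hfg β hβ => hfg β ⟨bot_le, hβ⟩⟩

end OmegaOmegaBased

theorem IsSuslin.exists_continuousMap_surjective {Y : Type u} [TopologicalSpace Y] [Nonempty Y]
    (h : IsSuslin Y) : ∃ Φ : C(ℕ → ℕ, Y), Function.Surjective Φ := by
  obtain ⟨P, _, _, f, hf, hf_surj⟩ := h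
  have : Nonempty P := hf_surj.nonempty
  obtain ⟨g, hg, hg_surj⟩ := PolishSpace.exists_nat_nat_continuous_surjective P
  exact ⟨⟨f ∘ g, hf.comp hg⟩, hf_surj.comp hg_surj⟩

section CompletelyRegular

variable {X : Type u} [TopologicalSpace X]

theorem exists_continuousMap_eq_zero_and_lt_one_imp_mem [CompletelyRegularSpace X] {x : X}
    {s : Set X} (hs : s ∈ 𝓝 x) : ∃ f : C(X, ℝ), f x = 0 ∧ ∀ y, f y < 1 → y ∈ s := by
  obtain ⟨V, hVs, hV, hxV⟩ := mem_nhds_iff.1 hs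
  obtain ⟨f, hf, hfx, hfV⟩ := CompletelyRegularSpace.completely_regular_isOpen x V hV hxV
  refine ⟨⟨fun y => f y, by fun_prop⟩, by simp [hfx], fun y hy => hVs ?_⟩
  by_contra hyV
  simp [hfV hyV] at hy

/-- One point is chosen in each nonempty set `{x | ∀ p ∈ b, F p x < 1}`, where `b` runs over a
countable base of `P`. -/
theorem separableSpace_of_surjective [CompletelyRegularSpace X] {P : Type*} [TopologicalSpace P]
    [SecondCountableTopology P] {F : P → C(X, ℝ)} (hF : Function.Surjective F)
    (hF_cont : ∀ x, Continuous fun p => F p x) : TopologicalSpace.SeparableSpace X := by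
  let N : Set P → Set X := fun b => {x | ∀ p ∈ b, F p x < 1}
  let 𝒩 : Set (Set P) := {b ∈ TopologicalSpace.countableBasis P | (N b).Nonempty}
  have : Countable 𝒩 :=
    ((TopologicalSpace.countable_countableBasis P).mono (Set.sep_subset _ _)).to_subtype
  refine ⟨Set.range fun b : 𝒩 => b.2.2.some, Set.countable_range _, fun x => ?_⟩
  refine mem_closure_iff_nhds.2 fun s hs => ?_
  obtain ⟨f, hfx, hfs⟩ := exists_continuousMap_eq_zero_and_lt_one_imp_mem hs
  obtain ⟨p, rfl⟩ := hF f
  have hlt : {q | F q x < 1} ∈ 𝓝 p :=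
    (hF_cont x).continuousAt.eventually_lt_const (hfx.trans_lt one_pos)
  obtain ⟨b, hb, hpb, hbN⟩ := (TopologicalSpace.isBasis_countableBasis P).mem_nhds_iff.1 hlt
  have hb' : b ∈ 𝒩 := ⟨hb, x, hbN⟩
  exact ⟨_, hfs _ (hb'.2.some_mem p hpb), ⟨b, hb'⟩, rfl⟩

variable {P : Type*} [TopologicalSpace P]

/-- The function `δ_x ∘ Φ` on a space `P` that parametrizes continuous functions on `X` by `Φ`. -/
def evalAlong (Φ : C(P, C(X, ℝ))) (x : X) : C(P, ℝ) :=
  (diracFunctional x).comp Φ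

variable [CompletelyRegularSpace X] {Φ : C(P, C(X, ℝ))}

theorem isInducing_evalAlong (hX : IsAscoli X) (hΦ : Function.Surjective Φ) :
    IsInducing (evalAlong Φ) := by
  have hcont : Continuous (evalAlong Φ) := (ContinuousMap.continuous_precomp Φ).comp hX
  refine isInducing_iff_nhds.2 fun x => le_antisymm (hcont.tendsto x).le_comap fun s hs => ?_
  obtain ⟨f, hfx, hfs⟩ := exists_continuousMap_eq_zero_and_lt_one_imp_mem hs
  obtain ⟨p, rfl⟩ := hΦ f
  have hlt : {g : C(P, ℝ) | g p < 1} ∈ 𝓝 (evalAlong Φ x) :=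
    (continuous_eval_const p).continuousAt.eventually_lt_const (hfx.trans_lt one_pos)
  exact ⟨_, hlt, hfs⟩

theorem isRealUniversal_comap_evalAlong (hX : IsAscoli X) (hΦ : Function.Surjective Φ) :
    IsRealUniversal (.comap (evalAlong Φ) inferInstance) := by
  refine ⟨(isInducing_evalAlong hX hΦ).eq_induced.symm, fun f hf => ?_⟩
  obtain ⟨p, hp⟩ := hΦ ⟨f, hf⟩
  have hf_eq : f = (fun g : C(P, ℝ) => g p) ∘ evalAlong Φ := (congrArg DFunLike.coe hp).symm
  rw [hf_eq]
  exact Tendsto.comp (uniformContinuous_eval_continuousMap p) tendsto_comap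

end CompletelyRegular

theorem theorem1p5 {X : Type u} [TopologicalSpace X] [T35Space X] :
    (TopologicalSpace.SeparableSpace X →
      (∃ 𝒰 : UniformSpace X, IsRealUniversal 𝒰 ∧ IsOmegaOmegaBased 𝒰) →
        IsSuslin C(X, ℝ)) ∧
    (IsAscoli X → IsSuslin C(X, ℝ) →
      TopologicalSpace.SeparableSpace X ∧
        ∃ 𝒰 : UniformSpace X, IsRealUniversal 𝒰 ∧ IsOmegaOmegaBased 𝒰) := by
  refine ⟨fun hsep => ?_, fun hX hC => ?_⟩
  · rintro ⟨𝒰, ⟨rfl, huc⟩, h𝒰⟩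
    exact h𝒰.isSuslin_continuousMap fun f => huc f f.continuous
  · obtain ⟨Φ, hΦ⟩ := hC.exists_continuousMap_surjective
    exact ⟨separableSpace_of_surjective hΦ fun x => (evalAlong Φ x).continuous,
      .comap (evalAlong Φ) inferInstance, isRealUniversal_comap_evalAlong hX hΦ,
      isOmegaOmegaBased_continuousMap.comap (evalAlong Φ)⟩
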